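/- Let $P$ be a simple closed polygon in the Euclidean plane with vertices $V_1,\dots,V_n$ in cyclic order (indices modulo $n$), where $n\ge 6$. Assume that $P$ is convex (for each edge, all vertices lie in one closed half-plane bounded by the line through that edge) and generic (no circle passes through more than three vertices, and no three vertices are collinear). For each $i$ let $C_i$ be the circle through $V_{i-1},V_i,V_{i+1}$. Call $C_i$ empty if none of the other vertices lies in its interior, and full if all of the other vertices lie in its interior. Let $s_-(P)$ be the number of indices $i$ for which $C_i$ is empty, and $s_+(P)$ the number of indices $i$ for which $C_i$ is full. Then $$s_+(P)+s_-(P)\ge 4,$$ and in fact $s_-(P)\ge 2$ and $s_+(P)\ge 2$. -/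

import Mathlib

namespace Polygon

/-- The Euclidean plane. -/
abbrev Plane : Type := EuclideanSpace ℝ (Fin 2)

variable {n : ℕ}

/-- The vertex index `i + 1`, taken modulo the number of vertices. -/
abbrev next (i : Fin n) : Fin n := finRotate n i

/-- The vertex index `i - 1`, taken modulo the number of vertices. -/
abbrev prev (i : Fin n) : Fin n := (finRotate n).symm i

/-- The closed polygonal curve is simple: when each edge is taken with its initial but without its
terminal vertex, no point of the plane is visited twice. -/
def IsSimple (P : Polygon Plane n) : Prop :=
  ∀ i j : Fin n, ∀ s ∈ Set.Ico (0 : ℝ) 1, ∀ t ∈ Set.Ico (0 : ℝ) 1,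
    P.edgePath ℝ i s = P.edgePath ℝ j t → i = j ∧ s = t

/-- The polygon is convex: for every edge, all vertices lie in one closed half-plane bounded by
the line through that edge. -/
def IsConvex (P : Polygon Plane n) : Prop :=
  ∀ i j k : Fin n, line[ℝ, P i, P (next i)].WSameSide (P j) (P k)

/-- The polygon is generic: no circle passes through more than three vertices, and no three
vertices are collinear. -/
def IsGeneric (P : Polygon Plane n) : Prop :=
  (∀ S : EuclideanGeometry.Sphere Plane, {i : Fin n | P i ∈ S}.ncard ≤ 3) ∧
    ∀ i j k : Fin n, i ≠ j → j ≠ k → i ≠ k → ¬ Collinear ℝ {P i, P j, P k}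

/-- The circle `S` passes through the vertices with indices `i`, `j`, `k`. -/
def PassesThrough (P : Polygon Plane n) (S : EuclideanGeometry.Sphere Plane) (i j k : Fin n) :
    Prop :=
  P i ∈ S ∧ P j ∈ S ∧ P k ∈ S

/-- `S` is an empty circle through the vertices `i`, `j`, `k`: no other vertex is in its
interior. -/
def IsEmptyCircle (P : Polygon Plane n) (S : EuclideanGeometry.Sphere Plane) (i j k : Fin n) :
    Prop :=
  P.PassesThrough S i j k ∧
    ∀ l : Fin n, l ≠ i → l ≠ j → l ≠ k → ¬ dist (P l) S.center < S.radius

/-- `S` is a full circle through the vertices `i`, `j`, `k`: all other vertices are in its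
interior. -/
def IsFullCircle (P : Polygon Plane n) (S : EuclideanGeometry.Sphere Plane) (i j k : Fin n) :
    Prop :=
  P.PassesThrough S i j k ∧
    ∀ l : Fin n, l ≠ i → l ≠ j → l ≠ k → dist (P l) S.center < S.radius

/-- The vertex `i` is globally maximal: the circle through the vertices `i - 1`, `i`, `i + 1`
is empty. -/
def IsGloballyMaximal (P : Polygon Plane n) (i : Fin n) : Prop :=
  ∃ S : EuclideanGeometry.Sphere Plane, P.IsEmptyCircle S (prev i) i (next i)

/-- The vertex `i` is globally minimal: the circle through the vertices `i - 1`, `i`, `i + 1`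
is full. -/
def IsGloballyMinimal (P : Polygon Plane n) (i : Fin n) : Prop :=
  ∃ S : EuclideanGeometry.Sphere Plane, P.IsFullCircle S (prev i) i (next i)

/-- The number `s₋(P)` of globally maximal vertices (those with an empty circle). -/
noncomputable def sMinus (P : Polygon Plane n) : ℕ :=
  {i : Fin n | P.IsGloballyMaximal i}.ncard

/-- The number `s₊(P)` of globally minimal vertices (those with a full circle). -/
noncomputable def sPlus (P : Polygon Plane n) : ℕ :=
  {i : Fin n | P.IsGloballyMinimal i}.ncard

end Polygon

namespace Polygon

/-! Lift each vertex to height `x² + y²`. A plane below all lifted points and touching three of them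
projects to a circle through those three with no vertex inside; heights `-(x² + y²)` give circles
with no vertex outside (`HasEarAt.exists_sphere`). The lower hull of the lifted points triangulates
the polygon, and such a triangulation has two ears, that is, triangles on three consecutive
vertices. The triangulation is never built. For arbitrary heights over points in convex position, a
support exact along a chord is tilted until it meets a further vertex
(`exists_supportedAt_between`), and descent to shorter chords ends in an ear (`exists_ear_between`).
The triangle on the closing edge has two sides to descend from, whence `exists_two_ears`. -/

/-- Twice the signed area of the triangle with vertices `(X i, Y i)`, `(X j, Y j)`, `(X k, Y k)`. -/
def orient (X Y : ℕ → ℝ) (i j k : ℕ) : ℝ :=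
  (X j - X i) * (Y k - Y i) - (Y j - Y i) * (X k - X i)

/-- The affine function with coefficients `α`, `β`, `γ` bounds the heights `H` from below
at the first `n` points. -/
def IsSupport (X Y H : ℕ → ℝ) (n : ℕ) (α β γ : ℝ) : Prop :=
  ∀ l < n, α * X l + β * Y l + γ ≤ H l

/-- Some affine function bounds the heights `H` from below and is exact at `i`, `j`, `k`. -/
def SupportedAt (X Y H : ℕ → ℝ) (n i j k : ℕ) : Prop :=
  ∃ α β γ : ℝ, IsSupport X Y H n α β γ ∧ α * X i + β * Y i + γ = H i ∧
    α * X j + β * Y j + γ = H j ∧ α * X k + β * Y k + γ = H k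

/-! ### Orientations and convex position. -/

theorem orient_cycle (X Y : ℕ → ℝ) (i j k : ℕ) : orient X Y i j k = orient X Y j k i := by
  unfold orient; ring

theorem orient_swap_right (X Y : ℕ → ℝ) (i j k : ℕ) : orient X Y i k j = -orient X Y i j k := by
  unfold orient; ring

theorem orient_swap_coords (X Y : ℕ → ℝ) (i j k : ℕ) : orient Y X i j k = -orient X Y i j k := by
  unfold orient; ring

/-- A polygon all of whose vertices lie strictly to the left of each edge is in convex position. -/
theorem orient_pos_of_edges {X Y : ℕ → ℝ} {n : ℕ}
    (h : ∀ i k, i + 1 < n → k < n → k ≠ i → k ≠ i + 1 → 0 < orient X Y i (i + 1) k)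
    {i j k : ℕ} (hij : i < j) (hjk : j < k) (hk : k < n) : 0 < orient X Y i j k := by
  induction k, hjk using Nat.le_induction with
  | base =>
    rw [orient_cycle]
    exact h j i hk (by omega) (by omega) (by omega)
  | succ k hjk ih =>
    have h1 := ih (by omega)
    have h2 : 0 < orient X Y i k (k + 1) := by
      rw [orient_cycle]
      exact h k i hk (by omega) (by omega) (by omega)
    have h3 := h i k (by omega) (by omega) (by omega) (by omega)
    have h4 := h i (k + 1) (by omega) (by omega) (by omega) (by omega)
    have h5 : 0 ≤ orient X Y i (i + 1) j := by
      rcases eq_or_ne j (i + 1) with rfl | hne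
      · unfold orient; apply le_of_eq; ring
      · exact (h i j (by omega) (by omega) (by omega) hne).le
    -- The three-term Plücker relation for the vectors from vertex `i` to `i + 1`, `j`, `k`, `k +
    -- 1`.
    have key : orient X Y i (i + 1) k * orient X Y i j (k + 1) =
        orient X Y i (i + 1) j * orient X Y i k (k + 1) +
          orient X Y i (i + 1) (k + 1) * orient X Y i j k := by
      unfold orient; ring
    have : 0 < orient X Y i (i + 1) k * orient X Y i j (k + 1) := by
      rw [key]; positivity
    exact pos_of_mul_pos_right this h3.le

/-! ### Supports, chords and ears. -/

/-- Tilting a support about the chord `a b` until it meets a vertex between `a` and `b`. -/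
theorem exists_supportedAt_between {X Y : ℕ → ℝ} (H : ℕ → ℝ) {n : ℕ}
    (ho : ∀ i j k, i < j → j < k → k < n → 0 < orient X Y i j k)
    {a b : ℕ} (hab : a + 1 < b) (hb : b < n) (hs : SupportedAt X Y H n a b b) :
    ∃ k, a < k ∧ k < b ∧ SupportedAt X Y H n a k b := by
  obtain ⟨α, β, γ, hsup, ha, hb', -⟩ := hs
  have hL : ∀ l, a < l → l < b → 0 < orient X Y a l b := fun l h1 h2 => ho a l b h1 h2 hb
  -- `orient X Y a l b` is affine in the point `l` and vanishes on the line `a b`. The least ratio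
  -- is the largest multiple of it that can be added before the function passes a height between `a`
  -- and `b`.
  obtain ⟨k, hk, hmin⟩ := Finset.exists_min_image (Finset.Ioo a b)
    (fun l => (H l - (α * X l + β * Y l + γ)) / orient X Y a l b)
    ⟨a + 1, Finset.mem_Ioo.2 ⟨by omega, hab⟩⟩
  obtain ⟨hak, hkb⟩ := Finset.mem_Ioo.1 hk
  set t := (H k - (α * X k + β * Y k + γ)) / orient X Y a k b with ht
  have htk : t * orient X Y a k b = H k - (α * X k + β * Y k + γ) :=
    div_mul_cancel₀ _ (hL k hak hkb).ne'
  have ht0 : 0 ≤ t := div_nonneg (sub_nonneg.2 (hsup k (by omega))) (hL k hak hkb).le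
  have hform : ∀ l, (α + t * (Y b - Y a)) * X l + (β - t * (X b - X a)) * Y l +
      (γ + t * (Y a * (X b - X a) - X a * (Y b - Y a))) =
        α * X l + β * Y l + γ + t * orient X Y a l b := by
    intro l; unfold orient; ring
  refine ⟨k, hak, hkb, _, _, _, fun l hl => (hform l).trans_le ?_, ?_, ?_, ?_⟩
  · by_cases hbet : a < l ∧ l < b
    · have := hmin l (Finset.mem_Ioo.2 hbet)
      rw [le_div_iff₀ (hL l hbet.1 hbet.2)] at this
      linarith
    · have hle : orient X Y a l b ≤ 0 := by
        rcases lt_trichotomy l a with h | rfl | h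
        · have := ho l a b h (by omega) hb
          rw [orient_cycle, orient_swap_right] at this
          linarith
        · unfold orient; apply le_of_eq; ring
        · rcases eq_or_ne l b with rfl | hne
          · unfold orient; apply le_of_eq; ring
          · have := ho a b l (by omega) (by omega) hl
            rw [orient_swap_right]
            linarith
      have := hsup l hl
      nlinarith
  · rw [hform, show orient X Y a a b = 0 by unfold orient; ring]; linarith
  · rw [hform]; linarith
  · rw [hform, show orient X Y a b b = 0 by unfold orient; ring]; linarith

/-- A repeated last index encodes exactness on a chord only, so each new side of a triangle can
serve as the next hinge. -/
theorem SupportedAt.left {X Y H : ℕ → ℝ} {n a k b : ℕ} (h : SupportedAt X Y H n a k b) :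
    SupportedAt X Y H n a k k := by
  obtain ⟨α, β, γ, h0, h1, h2, -⟩ := h
  exact ⟨α, β, γ, h0, h1, h2, h2⟩

theorem SupportedAt.right {X Y H : ℕ → ℝ} {n a k b : ℕ} (h : SupportedAt X Y H n a k b) :
    SupportedAt X Y H n k b b := by
  obtain ⟨α, β, γ, h0, -, h1, h2⟩ := h
  exact ⟨α, β, γ, h0, h1, h2, h2⟩

theorem SupportedAt.rotate {X Y H : ℕ → ℝ} {n a k b : ℕ} (h : SupportedAt X Y H n a k b) :
    SupportedAt X Y H n b a k := by
  obtain ⟨α, β, γ, h0, h1, h2, h3⟩ := h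
  exact ⟨α, β, γ, h0, h3, h1, h2⟩

/-- Beyond every supported chord there is a supported ear. -/
theorem exists_ear_between {X Y : ℕ → ℝ} (H : ℕ → ℝ) {n : ℕ}
    (ho : ∀ i j k, i < j → j < k → k < n → 0 < orient X Y i j k)
    {a b : ℕ} (hab : a + 1 < b) (hb : b < n) (hs : SupportedAt X Y H n a b b) :
    ∃ i, a ≤ i ∧ i + 2 ≤ b ∧ SupportedAt X Y H n i (i + 1) (i + 2) := by
  induction hd : b - a using Nat.strong_induction_on generalizing a b with
  | _ d ih =>
    obtain ⟨k, hak, hkb, hk⟩ := exists_supportedAt_between H ho hab hb hs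
    by_cases h1 : a + 1 < k
    · obtain ⟨i, hi, hi', h⟩ := ih (k - a) (by omega) h1 (by omega) hk.left rfl
      exact ⟨i, hi, by omega, h⟩
    by_cases h2 : k + 1 < b
    · obtain ⟨i, hi, hi', h⟩ := ih (b - k) (by omega) h2 hb hk.right rfl
      exact ⟨i, by omega, hi', h⟩
    obtain rfl : k = a + 1 := by omega
    obtain rfl : b = a + 2 := by omega
    exact ⟨a, le_rfl, le_rfl, hk⟩

/-- All other vertices lie on one side of this edge, so any affine function exact at its ends can be
tilted below them; the tilt may have either sign. -/
theorem supportedAt_closing_edge {X Y : ℕ → ℝ} (H : ℕ → ℝ) {m : ℕ} (hm : 2 ≤ m)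
    (ho : ∀ i j k, i < j → j < k → k < m + 1 → 0 < orient X Y i j k) :
    SupportedAt X Y H (m + 1) 0 m m := by
  have hL : ∀ l, 0 < l → l < m → 0 < orient X Y 0 l m := fun l h1 h2 => ho 0 l m h1 h2 (by omega)
  obtain ⟨α, β, γ, h0, h1⟩ : ∃ α β γ : ℝ, α * X 0 + β * Y 0 + γ = H 0 ∧
      α * X m + β * Y m + γ = H m := by
    by_cases hX : X m - X 0 = 0
    · have hY : Y m - Y 0 ≠ 0 := by
        intro hY
        have := hL 1 (by omega) (by omega)
        have e1 : X m = X 0 := by linarith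
        have e2 : Y m = Y 0 := by linarith
        simp [orient, e1, e2] at this
      refine ⟨0, (H m - H 0) / (Y m - Y 0), H 0 - (H m - H 0) / (Y m - Y 0) * Y 0, by ring, ?_⟩
      have := div_mul_cancel₀ (H m - H 0) hY
      linarith
    · refine ⟨(H m - H 0) / (X m - X 0), 0, H 0 - (H m - H 0) / (X m - X 0) * X 0, by ring, ?_⟩
      have := div_mul_cancel₀ (H m - H 0) hX
      linarith
  obtain ⟨k, hk, hmin⟩ := Finset.exists_min_image (Finset.Ioo 0 m)
    (fun l => (H l - (α * X l + β * Y l + γ)) / orient X Y 0 l m)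
    ⟨1, Finset.mem_Ioo.2 ⟨by omega, by omega⟩⟩
  set t := (H k - (α * X k + β * Y k + γ)) / orient X Y 0 k m with ht
  have hform : ∀ l, (α + t * (Y m - Y 0)) * X l + (β - t * (X m - X 0)) * Y l +
      (γ + t * (Y 0 * (X m - X 0) - X 0 * (Y m - Y 0))) =
        α * X l + β * Y l + γ + t * orient X Y 0 l m := by
    intro l; unfold orient; ring
  have e0 : orient X Y 0 0 m = 0 := by unfold orient; ring
  have em : orient X Y 0 m m = 0 := by unfold orient; ring
  refine ⟨_, _, _, fun l hl => (hform l).trans_le ?_, by rw [hform, e0]; linarith,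
    by rw [hform, em]; linarith, by rw [hform, em]; linarith⟩
  rcases Nat.eq_zero_or_pos l with rfl | hl0
  · rw [e0]; linarith
  rcases eq_or_ne l m with rfl | hne
  · rw [em]; linarith
  have := hmin l (Finset.mem_Ioo.2 ⟨hl0, by omega⟩)
  rw [le_div_iff₀ (hL l hl0 (by omega))] at this
  linarith

/-- Some affine function bounds the heights `H` from below and is exact at `i` and at both of its
neighbours in the cyclic order of `0, …, m`. -/
def HasEarAt (X Y H : ℕ → ℝ) (m i : ℕ) : Prop :=
  i < m + 1 ∧ ∃ p q, p < m + 1 ∧ q < m + 1 ∧ (p + 1 = i ∨ p = m ∧ i = 0) ∧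
    (i + 1 = q ∨ i = m ∧ q = 0) ∧ SupportedAt X Y H (m + 1) p i q

theorem HasEarAt.swap_coords {X Y H : ℕ → ℝ} {m i : ℕ} (h : HasEarAt X Y H m i) :
    HasEarAt Y X H m i := by
  obtain ⟨hi, p, q, hp, hq, hpi, hiq, α, β, γ, h0, h1, h2, h3⟩ := h
  exact ⟨hi, p, q, hp, hq, hpi, hiq, β, α, γ, fun l hl => by linarith [h0 l hl], by linarith,
    by linarith, by linarith⟩

/-- Points in convex position with arbitrary heights have two distinct supported ears. -/
theorem exists_two_ears {X Y : ℕ → ℝ} (H : ℕ → ℝ) {m : ℕ} (hm : 3 ≤ m)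
    (ho : ∀ i j k, i < j → j < k → k < m + 1 → 0 < orient X Y i j k) :
    ∃ i i', i ≠ i' ∧ HasEarAt X Y H m i ∧ HasEarAt X Y H m i' := by
  obtain ⟨k, hak, hkb, hk⟩ := exists_supportedAt_between H ho (by omega) (by omega)
    (supportedAt_closing_edge H (by omega) ho)
  have mid : ∀ {i}, i + 2 ≤ m → SupportedAt X Y H (m + 1) i (i + 1) (i + 2) →
      HasEarAt X Y H m (i + 1) := fun {i} hi h =>
    ⟨by omega, i, i + 2, by omega, by omega, Or.inl rfl, Or.inl rfl, h⟩
  by_cases h1 : 1 < k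
  · obtain ⟨i, -, hi, hs⟩ := exists_ear_between H ho (by omega) (by omega) hk.left
    refine ⟨i + 1, ?_⟩
    by_cases h2 : k + 1 < m
    · obtain ⟨j, hj, hj', hs'⟩ := exists_ear_between H ho h2 (by omega) hk.right
      exact ⟨j + 1, by omega, mid (by omega) hs, mid hj' hs'⟩
    -- Here `k = m - 1`, so the triangle `0 k m` is itself an ear, with tip `m`.
    · exact ⟨m, by omega, mid (by omega) hs, by omega, k, 0, by omega, by omega,
        Or.inl (by omega), Or.inr ⟨rfl, rfl⟩, hk.rotate.rotate⟩
  -- Here `k = 1`, so the tip is `0`; `3 ≤ m` leaves a vertex beyond the chord `1 m`.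
  · obtain ⟨j, hj, hj', hs'⟩ := exists_ear_between H ho (by omega) (by omega) hk.right
    exact ⟨0, j + 1, by omega, ⟨by omega, m, k, by omega, by omega, Or.inr ⟨rfl, rfl⟩,
      Or.inl (by omega), hk.rotate⟩, mid hj' hs'⟩

/-! ### From the geometric hypotheses to orientations. -/

theorem collinear_of_det_eq_zero {A B C : Plane}
    (h : (B 0 - A 0) * (C 1 - A 1) - (B 1 - A 1) * (C 0 - A 0) = 0) : Collinear ℝ {A, B, C} := by
  by_cases hAB : B = A
  · subst hAB
    simpa using collinear_pair ℝ B C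
  have hpos : (B 0 - A 0) ^ 2 + (B 1 - A 1) ^ 2 ≠ 0 := by
    intro h0
    apply hAB
    ext i
    fin_cases i
    · simp only [Fin.zero_eta]
      nlinarith [sq_nonneg (B 0 - A 0), sq_nonneg (B 1 - A 1)]
    · simp only [Fin.mk_one]
      nlinarith [sq_nonneg (B 0 - A 0), sq_nonneg (B 1 - A 1)]
  rw [collinear_iff_of_mem (p₀ := A) (by simp)]
  refine ⟨B - A, ?_⟩
  simp only [Set.mem_insert_iff, Set.mem_singleton_iff, forall_eq_or_imp, forall_eq, vadd_eq_add]
  refine ⟨⟨0, by simp⟩, ⟨1, by simp⟩,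
    -- The coefficient of the orthogonal projection of `C - A` onto `B - A`.
    ((B 0 - A 0) * (C 0 - A 0) + (B 1 - A 1) * (C 1 - A 1)) /
      ((B 0 - A 0) ^ 2 + (B 1 - A 1) ^ 2), ?_⟩
  ext i
  fin_cases i
  · simp only [Fin.zero_eta, PiLp.add_apply, PiLp.smul_apply, PiLp.sub_apply, smul_eq_mul]
    field_simp
    linear_combination (-(B 1 - A 1)) * h
  · simp only [Fin.mk_one, PiLp.add_apply, PiLp.smul_apply, PiLp.sub_apply, smul_eq_mul]
    field_simp
    linear_combination (B 0 - A 0) * h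

/-- Modulo the direction of the line, both points are nonnegative multiples of one vector `u`. -/
theorem det_mul_det_nonneg_of_wSameSide {A B C D : Plane} (h : line[ℝ, A, B].WSameSide C D) :
    0 ≤ ((B 0 - A 0) * (C 1 - A 1) - (B 1 - A 1) * (C 0 - A 0)) *
      ((B 0 - A 0) * (D 1 - A 1) - (B 1 - A 1) * (D 0 - A 0)) := by
  obtain ⟨p, hp, q, hq, hray⟩ := h
  obtain ⟨r, rfl⟩ := mem_affineSpan_pair_iff_exists_lineMap_eq.1 hp
  obtain ⟨s, rfl⟩ := mem_affineSpan_pair_iff_exists_lineMap_eq.1 hq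
  obtain ⟨u, a, b, ha, hb, -, hC, hD⟩ := hray.exists_eq_smul
  have c0 := congrArg (fun v : Plane => v 0) hC
  have c1 := congrArg (fun v : Plane => v 1) hC
  have d0 := congrArg (fun v : Plane => v 0) hD
  have d1 := congrArg (fun v : Plane => v 1) hD
  simp only [AffineMap.lineMap_apply, vsub_eq_sub, vadd_eq_add, PiLp.sub_apply, PiLp.add_apply,
    PiLp.smul_apply, smul_eq_mul] at c0 c1 d0 d1
  have e1 : (B 0 - A 0) * (C 1 - A 1) - (B 1 - A 1) * (C 0 - A 0) =
      a * ((B 0 - A 0) * u 1 - (B 1 - A 1) * u 0) := by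
    linear_combination (B 0 - A 0) * c1 - (B 1 - A 1) * c0
  have e2 : (B 0 - A 0) * (D 1 - A 1) - (B 1 - A 1) * (D 0 - A 0) =
      b * ((B 0 - A 0) * u 1 - (B 1 - A 1) * u 0) := by
    linear_combination (B 0 - A 0) * d1 - (B 1 - A 1) * d0
  rw [e1, e2, mul_mul_mul_comm]
  exact mul_nonneg (mul_nonneg ha hb) (mul_self_nonneg _)

/-- If each edge has all points on one side, and no three points are collinear, then the first
triple determines the orientation of every edge. -/
theorem orient_edge_pos {X Y : ℕ → ℝ} {n : ℕ} (hn : 3 ≤ n)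
    (hside : ∀ i j k, i + 1 < n → j < n → k < n →
      0 ≤ orient X Y i (i + 1) j * orient X Y i (i + 1) k)
    (hne : ∀ i j k, i < n → j < n → k < n → i ≠ j → j ≠ k → i ≠ k → orient X Y i j k ≠ 0)
    (h012 : 0 < orient X Y 0 1 2) (i k : ℕ) (hi : i + 1 < n) (hk : k < n) (hki : k ≠ i)
    (hki' : k ≠ i + 1) : 0 < orient X Y i (i + 1) k := by
  have step : ∀ i l k, i + 1 < n → l < n → k < n → k ≠ i → k ≠ i + 1 →
      0 < orient X Y i (i + 1) l → 0 < orient X Y i (i + 1) k := fun i l k hi hl hk h1 h2 hpos =>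
    (nonneg_of_mul_nonneg_right (hside i l k hi hl hk) hpos).lt_of_ne'
      (hne i (i + 1) k (by omega) hi hk (by omega) (by omega) (by omega))
  induction i generalizing k with
  | zero => exact step 0 2 k hi (by omega) hk hki hki' h012
  | succ i ih =>
    -- Consecutive edges share the triple `i`, `i + 1`, `i + 2`, which carries the sign from one to
    -- the next.
    refine step (i + 1) i k hi (by omega) hk hki hki' ?_
    rw [← orient_cycle]
    exact ih (i + 1 + 1) (by omega) hi (by omega) (by omega)

theorem next_ofNat {m i q : ℕ} (hi : i < m + 1) (hq : q < m + 1)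
    (h : i + 1 = q ∨ i = m ∧ q = 0) : next (Fin.ofNat (m + 1) i) = Fin.ofNat (m + 1) q := by
  rw [next, finRotate_apply]
  rcases h with rfl | ⟨rfl, rfl⟩ <;> ext <;> simp [Fin.val_add]

theorem prev_ofNat {m p i : ℕ} (hp : p < m + 1) (hi : i < m + 1)
    (h : p + 1 = i ∨ p = m ∧ i = 0) : prev (Fin.ofNat (m + 1) i) = Fin.ofNat (m + 1) p := by
  rw [prev, Equiv.symm_apply_eq]
  exact (next_ofNat hp hi h).symm

/-- The coordinate `c` of the vertices, indexed by natural numbers. -/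
noncomputable def coord {m : ℕ} (P : Polygon Plane (m + 1)) (c : Fin 2) (l : ℕ) : ℝ :=
  P (Fin.ofNat (m + 1) l) c

theorem ofNat_ne_ofNat {m i j : ℕ} (hi : i < m + 1) (hj : j < m + 1) (hij : i ≠ j) :
    Fin.ofNat (m + 1) i ≠ Fin.ofNat (m + 1) j := by
  intro h
  have := congrArg Fin.val h
  simp only [Fin.val_ofNat, Nat.mod_eq_of_lt hi, Nat.mod_eq_of_lt hj] at this
  exact hij this

/-- For any heights, the vertices of a convex generic polygon have two supported ears. -/
theorem IsConvex.exists_two_ears {m : ℕ} {P : Polygon Plane (m + 1)} (hP : P.IsConvex)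
    (hgen : P.IsGeneric) (hm : 3 ≤ m) (H : ℕ → ℝ) :
    ∃ i i', i ≠ i' ∧ HasEarAt (P.coord 0) (P.coord 1) H m i ∧
      HasEarAt (P.coord 0) (P.coord 1) H m i' := by
  have hside : ∀ i j k, i + 1 < m + 1 → j < m + 1 → k < m + 1 →
      0 ≤ orient (P.coord 0) (P.coord 1) i (i + 1) j *
        orient (P.coord 0) (P.coord 1) i (i + 1) k := by
    intro i j k hi hj hk
    have h := hP (Fin.ofNat (m + 1) i) (Fin.ofNat (m + 1) j) (Fin.ofNat (m + 1) k)
    rw [next_ofNat (by omega) hi (Or.inl rfl)] at h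
    exact det_mul_det_nonneg_of_wSameSide h
  have hne : ∀ i j k, i < m + 1 → j < m + 1 → k < m + 1 → i ≠ j → j ≠ k → i ≠ k →
      orient (P.coord 0) (P.coord 1) i j k ≠ 0 := fun i j k hi hj hk hij hjk hik h0 =>
    hgen.2 _ _ _ (ofNat_ne_ofNat hi hj hij) (ofNat_ne_ofNat hj hk hjk) (ofNat_ne_ofNat hi hk hik)
      (collinear_of_det_eq_zero h0)
  rcases (hne 0 1 2 (by omega) (by omega) (by omega) (by omega) (by omega)
    (by omega)).lt_or_gt with h | h
  -- A clockwise polygon becomes counterclockwise on exchanging the coordinates; the heights stay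
  -- the same.
  · obtain ⟨i, i', hii', h1, h2⟩ := Polygon.exists_two_ears (X := P.coord 1) (Y := P.coord 0) H hm
      (fun i j k hij hjk hk => orient_pos_of_edges (orient_edge_pos (by omega)
        (fun i j k hi hj hk => by
          simpa only [orient_swap_coords (P.coord 0), neg_mul_neg] using hside i j k hi hj hk)
        (fun i j k hi hj hk hij hjk hik => by
          rw [orient_swap_coords]; exact neg_ne_zero.2 (hne i j k hi hj hk hij hjk hik))
        (by rw [orient_swap_coords]; exact neg_pos.2 h)) hij hjk hk)
    exact ⟨i, i', hii', h1.swap_coords, h2.swap_coords⟩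
  · exact Polygon.exists_two_ears H hm (fun i j k hij hjk hk =>
      orient_pos_of_edges (orient_edge_pos (by omega) hside hne h) hij hjk hk)

/-! ### From supports to circles. -/

/-- A supported ear over the paraboloid `z = σ (x² + y²)`, `σ = ±1`, projects to a circle with all
vertices weakly outside (`σ = 1`) or weakly inside (`σ = -1`). -/
theorem HasEarAt.exists_sphere {m : ℕ} {P : Polygon Plane (m + 1)} {σ : ℝ} (hσ : σ * σ = 1) {i : ℕ}
    (h : HasEarAt (P.coord 0) (P.coord 1) (fun l => σ * (P.coord 0 l ^ 2 + P.coord 1 l ^ 2)) m i) :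
    ∃ S : EuclideanGeometry.Sphere Plane,
      P.PassesThrough S (prev (Fin.ofNat (m + 1) i)) (Fin.ofNat (m + 1) i)
        (next (Fin.ofNat (m + 1) i)) ∧ 0 ≤ S.radius ∧
      ∀ l, 0 ≤ σ * (dist (P l) S.center ^ 2 - S.radius ^ 2) := by
  obtain ⟨hi, p, q, hp, hq, hpi, hiq, α, β, γ, h0, h1, h2, h3⟩ := h
  rw [prev_ofNat hp hi hpi, next_ofNat hi hq hiq]
  -- Completing the square in `σ (x² + y²) = α x + β y + γ`, with `σ⁻¹ = σ`, gives this centre; the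
  -- gap above the support is then `σ` times the power of the point.
  set c : Plane := !₂[σ * α / 2, σ * β / 2] with hc
  have hd : ∀ l : Fin (m + 1), dist (P l) c ^ 2 =
      (P l 0 - σ * α / 2) ^ 2 + (P l 1 - σ * β / 2) ^ 2 := by
    intro l
    rw [EuclideanSpace.dist_sq_eq, Fin.sum_univ_two]
    simp [hc, Real.dist_eq, sq_abs]
  have hdist : ∀ l : ℕ, dist (P (Fin.ofNat (m + 1) l)) c ^ 2 =
      σ * (σ * (P.coord 0 l ^ 2 + P.coord 1 l ^ 2) -
        (α * P.coord 0 l + β * P.coord 1 l + γ)) +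
        (σ * γ + (σ * α / 2) ^ 2 + (σ * β / 2) ^ 2) := by
    intro l
    rw [hd]
    unfold coord
    linear_combination (-(P (Fin.ofNat (m + 1) l) 0 ^ 2 + P (Fin.ofNat (m + 1) l) 1 ^ 2)) * hσ
  have hr := hdist i
  rw [h2, sub_self, mul_zero, zero_add] at hr
  refine ⟨⟨c, dist (P (Fin.ofNat (m + 1) i)) c⟩, ⟨?_, rfl, ?_⟩, dist_nonneg, fun l => ?_⟩
  · rw [EuclideanGeometry.mem_sphere, ← sq_eq_sq₀ dist_nonneg dist_nonneg, hr, hdist, h1, sub_self,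
      mul_zero, zero_add]
  · rw [EuclideanGeometry.mem_sphere, ← sq_eq_sq₀ dist_nonneg dist_nonneg, hr, hdist, h3, sub_self,
      mul_zero, zero_add]
  · have hl := hdist l
    have hl0 := h0 l l.isLt
    rw [Fin.ofNat_val_eq_self] at hl
    rw [hr, hl, add_sub_cancel_right, ← mul_assoc, hσ, one_mul]
    exact sub_nonneg.2 hl0

theorem HasEarAt.isGloballyMaximal {m : ℕ} {P : Polygon Plane (m + 1)} {i : ℕ}
    (h : HasEarAt (P.coord 0) (P.coord 1) (fun l => 1 * (P.coord 0 l ^ 2 + P.coord 1 l ^ 2)) m i) :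
    P.IsGloballyMaximal (Fin.ofNat (m + 1) i) := by
  obtain ⟨S, hS, -, hl⟩ := h.exists_sphere (by norm_num)
  refine ⟨S, hS, fun l _ _ _ hlt => ?_⟩
  have := pow_lt_pow_left₀ hlt dist_nonneg two_ne_zero
  linarith [hl l]

/-- The support only places the vertices in the closed disc; a further vertex on the circle would be
a fourth, against genericity. -/
theorem HasEarAt.isGloballyMinimal {m : ℕ} {P : Polygon Plane (m + 1)} (hgen : P.IsGeneric)
    (hm : 3 ≤ m) {i : ℕ} (h : HasEarAt (P.coord 0) (P.coord 1)
      (fun l => -1 * (P.coord 0 l ^ 2 + P.coord 1 l ^ 2)) m i) :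
    P.IsGloballyMinimal (Fin.ofNat (m + 1) i) := by
  obtain ⟨S, hS, hr, hl⟩ := h.exists_sphere (by norm_num)
  obtain ⟨hi, p, q, hp, hq, hpi, hiq, -⟩ := h
  refine ⟨S, hS, fun l h1 h2 h3 => ?_⟩
  rw [prev_ofNat hp hi hpi] at h1 hS
  rw [next_ofNat hi hq hiq] at h3 hS
  have hle : dist (P l) S.center ≤ S.radius :=
    le_of_sq_le_sq (by linarith [hl l]) hr
  refine hle.lt_of_ne fun heq => ?_
  have hsub : ({l, Fin.ofNat (m + 1) p, Fin.ofNat (m + 1) i, Fin.ofNat (m + 1) q} :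
      Finset (Fin (m + 1))) ⊆ (Set.toFinite {i | P i ∈ S}).toFinset := by
    intro j hj
    simp only [Finset.mem_insert, Finset.mem_singleton] at hj
    rw [Set.Finite.mem_toFinset]
    rcases hj with rfl | rfl | rfl | rfl
    exacts [heq, hS.1, hS.2.1, hS.2.2]
  have hcard := Finset.card_le_card hsub
  rw [← Set.ncard_eq_toFinset_card, Finset.card_insert_of_notMem, Finset.card_insert_of_notMem,
    Finset.card_pair (ofNat_ne_ofNat hi hq (by omega))] at hcard
  · have := hgen.1 S
    omega
  · simp only [Finset.mem_insert, Finset.mem_singleton, not_or]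
    exact ⟨ofNat_ne_ofNat hp hi (by omega), ofNat_ne_ofNat hp hq (by omega)⟩
  · simp only [Finset.mem_insert, Finset.mem_singleton, not_or]
    exact ⟨h1, h2, h3⟩

end Polygon

theorem mainTheorem3 (n : ℕ) (hn : 6 ≤ n) (P : Polygon Polygon.Plane n)
    (hsimple : P.IsSimple) (hconvex : P.IsConvex) (hgeneric : P.IsGeneric) :
    4 ≤ P.sPlus + P.sMinus ∧ 2 ≤ P.sMinus ∧ 2 ≤ P.sPlus := by
  obtain ⟨m, rfl⟩ : ∃ m, n = m + 1 := ⟨n - 1, by omega⟩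
  have hminus : 2 ≤ P.sMinus := by
    obtain ⟨i, i', hne, h, h'⟩ := hconvex.exists_two_ears hgeneric (by omega)
      (fun l => 1 * (P.coord 0 l ^ 2 + P.coord 1 l ^ 2))
    exact (Set.one_lt_ncard).2 ⟨_, h.isGloballyMaximal, _, h'.isGloballyMaximal,
      Polygon.ofNat_ne_ofNat h.1 h'.1 hne⟩
  have hplus : 2 ≤ P.sPlus := by
    obtain ⟨i, i', hne, h, h'⟩ := hconvex.exists_two_ears hgeneric (by omega)
      (fun l => -1 * (P.coord 0 l ^ 2 + P.coord 1 l ^ 2))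
    exact (Set.one_lt_ncard).2 ⟨_, h.isGloballyMinimal hgeneric (by omega), _,
      h'.isGloballyMinimal hgeneric (by omega), Polygon.ofNat_ne_ofNat h.1 h'.1 hne⟩
  exact ⟨by omega, hminus, hplus⟩
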